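/- **Setting.** For an alphabet $A$, a *shift space* $\Lambda\subseteq A^{\mathbb N}$ is the set of all sequences avoiding a given set of nonempty forbidden words; $B(\Lambda)$ is its language (the empty word and all finite prefixes of its sequences), and $\mathcal F_\Lambda(w)=\{a\in A: wa\in B(\Lambda)\}$. A *family of blurred sets* is a family $\mathcal V$ of infinite subsets of $A$ such that distinct members have finite intersection. Each $H\in\mathcal V$ is labelled by a new symbol $\tilde H$; put $\tilde{\mathcal V}=\{\tilde H:H\in\mathcal V\}$, $\bar H=H\cup\{\tilde H\}$ and $\bar A=A\cup\tilde{\mathcal V}$. The *full blur shift* $\Sigma_{A^{\mathbb N}}^{\mathcal V}$ is the set of $x\in\bar A^{\mathbb N}$ such that $x_i=\tilde H$ implies $x_{i+1}=\tilde H$. It carries the topology having as a basis the *generalized cylinders* $$Z(w_0\dots w_{n-1})=\{x: x_i=w_i,\ i<n\},\qquad Z(w_0\dots w_{n-1}\bar H,F)=\{x: x_i=w_i,\ i<n,\ x_n\in\bar H\setminus F\},$$ where $n\ge 0$, $w_i\in A$, $H\in\mathcal V$, $F\subset H$ finite; write $Z(\alpha\bar H)$ when $F=\emptyset$. The *blur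 shift* $\Sigma_\Lambda$ of $\Lambda$ with resolution $\mathcal V$ is the union of $\Lambda$ and the set $\partial\Lambda$ of all $(a_0\dots a_{n-1}\tilde H\tilde H\dots)$ with $n\ge0$, $a_0\dots a_{n-1}\in B(\Lambda)$ and $\mathcal F_\Lambda(a_0\dots a_{n-1})\cap H$ infinite. It has the induced topology and the shift map $\sigma$, $\sigma(x)_i=x_{i+1}$. The generalized cylinders of $\Sigma_\Lambda$ are $Z_\Lambda(\alpha)=Z(\alpha)\cap\Sigma_\Lambda$ and $Z_\Lambda(\alpha\bar H,F)=Z(\alpha\bar H,F)\cap\Sigma_\Lambda$ with $\alpha\in B(\Lambda)$, $H\in\mathcal V$ containing infinitely many of the letters that occur in sequences of $\Lambda$, and $F\subset H$ finite. (For arbitrary $\alpha$, $H$ the same notation is used for the traces on $\Sigma_\Lambda$.) A *pseudo cylinder* of $\Sigma_\Lambda$ is the empty set or a set $\{x\in\Sigma_\Lambda: x_k\dots x_\ell=w\}$, where $0\le k\le \ell$ and $w$ is a word of length $\ell-k+1$ (over $\bar A$) occurring in $\Sigma_\Lambda$. A set $C\subseteq\Sigma_\Lambda$ is *finitely defined*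 if both $C$ and its complement are unions of pseudo cylinders. Let $\Sigma_\Lambda$ and $\Sigma_\Gamma$ be blur shifts over alphabets $A$ and $B$ with families of blurred sets $\mathcal V$ and $\mathcal U$, and let $\Phi:\Sigma_\Lambda\to\Sigma_\Gamma$ be a map. For $a\in\bar B=B\cup\tilde{\mathcal U}$ let $C_a=\{x\in\Sigma_\Lambda:\Phi(x)_0=a\}$. The map $\Phi$ is a *generalized sliding block code* if every $C_a$, $a\in\bar B$, is finitely defined and, for all $x\in\Sigma_\Lambda$ and $i\in\mathbb N$, $\Phi(x)_i$ is the unique $a\in\bar B$ with $\sigma^i(x)\in C_a$. **Theorem.** Suppose that $C_{\tilde G}$ is finitely defined for every $\tilde G\in\tilde{\mathcal U}$. Then $\Phi$ is continuous and shift commuting ($\Phi\circ\sigma=\sigma\circ\Phi$) if and only if $\Phi$ is a generalized sliding block code satisfying: 1. for every $b\in B$, the set $C_b$ is a (possibly empty) union of generalized cylinders of $\Sigma_\Lambda$; 2. if $(x_0\dots x_{n-1}\tilde H\tilde H\dots)\in\partial\Lambda$ is such that $\Phi(x_0\dots x_{n-1}\tilde H\tilde H\dots)=(\tilde G\tilde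 G\tilde G\dots)\in\partial\Gamma$, then (a) there is a finite $F\subset H$ with $\Phi\big(Z_\Lambda(x_0\dots x_{n-1}\bar H,F)\big)\subseteq Z_\Gamma(\bar G)$, and (b) for each $g\in G$ there are only finitely many $h\in H$ for which some sequence of the form $(x_0\dots x_{n-1}h\dots)$ belongs to $C_g$; 3. if $(\tilde H\tilde H\tilde H\dots)\in\partial\Lambda$ is such that $\Phi(\tilde H\tilde H\tilde H\dots)=(ddd\dots)\in\Gamma$, then for all $M\ge1$ there is a finite $F\subset H$ such that $\sigma^i\big(Z_\Lambda(\bar H,F)\big)\subseteq C_d$ for all $i=0,1,\dots,M$. -/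

import Mathlib

universe u v

namespace BlurShifts

/-! ### Words, languages and classical shift spaces -/

/-- The word `w` occurs in the sequence `x` at position `k`, i.e. `x_k x_{k+1} ⋯ = w`
on the first `w.length` symbols.  For `k = 0` this says that `w` is a prefix of `x`. -/
def OccursAt {X : Type u} (w : List X) (x : ℕ → X) (k : ℕ) : Prop :=
  ∀ (i : ℕ) (hi : i < w.length), x (k + i) = w[i]

/-- The language `B(S)`: the empty word, and all words that are prefixes of sequences of `S`. -/
def language {X : Type u} (S : Set (ℕ → X)) : Set (List X) :=
  {w | w = [] ∨ ∃ x ∈ S, OccursAt w x 0}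

/-- The follower set of the word `w` in `S`. -/
def followerSet {X : Type u} (S : Set (ℕ → X)) (w : List X) : Set X :=
  {a | w ++ [a] ∈ language S}

/-- A (one-sided) shift space over the alphabet `A`: the set of all sequences in which no word
of some set of nonempty forbidden words occurs. -/
structure ShiftSpace (A : Type u) where
  carrier : Set (ℕ → A)
  exists_forbidden : ∃ W : Set (List A), [] ∉ W ∧
    carrier = {x | ∀ w ∈ W, ∀ k : ℕ, ¬ OccursAt w x k}

/-- A family of blurred sets of the alphabet `A`: infinite sets, any two distinct ones of which
have finite intersection. -/
structure BlurFamily (A : Type u) where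
  sets : Set (Set A)
  infinite : ∀ H ∈ sets, H.Infinite
  finite_inter : ∀ G ∈ sets, ∀ H ∈ sets, G ≠ H → (G ∩ H).Finite

/-! ### Full blur shifts -/

/-- The extended alphabet: the letters `Sum.inl a` for `a` in `A`, and one new symbol `Sum.inr H`
for every blurred set `H`. -/
abbrev ExtAlphabet {A : Type u} (V : BlurFamily A) : Type u := A ⊕ V.sets

/-- The full blur shift: the sequences over the extended alphabet which, once a blurred symbol
appears, keep repeating it. -/
def FullBlurShift {A : Type u} (V : BlurFamily A) : Type u :=
  {x : ℕ → ExtAlphabet V // ∀ (i : ℕ) (H : V.sets), x i = Sum.inr H → x (i + 1) = Sum.inr H}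

instance {A : Type u} (V : BlurFamily A) :
    CoeFun (FullBlurShift V) (fun _ => ℕ → ExtAlphabet V) := ⟨fun x => x.1⟩

/-- The generalized cylinder `Z(α)`. -/
def cyl {A : Type u} (V : BlurFamily A) (α : List A) : Set (FullBlurShift V) :=
  {x | OccursAt (α.map Sum.inl) x 0}

/-- The generalized cylinder `Z(α H̄, F)`: sequences with prefix `α` whose next symbol is the
blurred symbol of `H` or a letter of `H \ F`. -/
def cylBlur {A : Type u} {V : BlurFamily A} (α : List A) (H : V.sets) (F : Set A) :
    Set (FullBlurShift V) :=
  {x | OccursAt (α.map Sum.inl) x 0 ∧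
    (x α.length = Sum.inr H ∨ ∃ h ∈ H.1 \ F, x α.length = Sum.inl h)}

/-- The topology whose basic open sets are the generalized cylinders. -/
instance {A : Type u} (V : BlurFamily A) : TopologicalSpace (FullBlurShift V) :=
  TopologicalSpace.generateFrom
    {Z | (∃ α : List A, Z = cyl V α) ∨
      ∃ (α : List A) (H : V.sets) (F : Set A), F.Finite ∧ F ⊆ H.1 ∧ Z = cylBlur α H F}

/-- The sequence `(a_0 ⋯ a_{n-1} H̃ H̃ H̃ ⋯)`. -/
def blurSeq {A : Type u} {V : BlurFamily A} (α : List A) (H : V.sets) : ℕ → ExtAlphabet V :=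
  fun i => if hi : i < α.length then Sum.inl α[i] else Sum.inr H

/-- The shift map on the full blur shift. -/
def FullBlurShift.shift {A : Type u} {V : BlurFamily A} (x : FullBlurShift V) :
    FullBlurShift V :=
  ⟨fun i => x (i + 1), fun i H h => x.2 (i + 1) H h⟩

/-! ### Blur shift spaces -/

/-- The blur shift space of the shift space `L` with resolution `V`, as a subset of the full blur
shift: the sequences of `L`, and the sequences `(a_0 ⋯ a_{n-1} H̃ H̃ ⋯)` for which
`a_0 ⋯ a_{n-1}` is in the language of `L` and is followed in `L` by infinitely many letters
of `H`. -/
def blurShiftSet {A : Type u} (V : BlurFamily A) (L : ShiftSpace A) : Set (FullBlurShift V) :=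
  {x | (∃ y ∈ L.carrier, ∀ i, x i = Sum.inl (y i)) ∨
    ∃ α ∈ language L.carrier, ∃ H : V.sets,
      (followerSet L.carrier α ∩ H.1).Infinite ∧ x.1 = blurSeq α H}

/-- The blur shift space as a topological space, with the topology induced from the full
blur shift. -/
abbrev BlurShift {A : Type u} (V : BlurFamily A) (L : ShiftSpace A) : Type u :=
  ↥(blurShiftSet V L)

theorem ShiftSpace.shift_mem {A : Type u} (L : ShiftSpace A) {y : ℕ → A} (hy : y ∈ L.carrier) :
    (fun i => y (i + 1)) ∈ L.carrier := by
  obtain ⟨W, -, hW⟩ := L.exists_forbidden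
  rw [hW] at hy ⊢
  intro w hw k hk
  refine hy w hw (k + 1) fun i hi => ?_
  have := hk i hi
  simpa [Nat.add_right_comm] using this

theorem ShiftSpace.language_tail {A : Type u} (L : ShiftSpace A) {a : A} {w : List A}
    (h : a :: w ∈ language L.carrier) : w ∈ language L.carrier := by
  rcases h with h | ⟨y, hy, h⟩
  · simp at h
  · refine Or.inr ⟨_, L.shift_mem hy, fun i hi => ?_⟩
    have := h (i + 1) (by simpa using hi)
    simpa using this

theorem shift_mem_blurShiftSet {A : Type u} {V : BlurFamily A} {L : ShiftSpace A}
    {x : FullBlurShift V} (hx : x ∈ blurShiftSet V L) : x.shift ∈ blurShiftSet V L := by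
  rcases hx with ⟨y, hy, h⟩ | ⟨α, hα, H, hH, h⟩
  · exact Or.inl ⟨_, L.shift_mem hy, fun i => h (i + 1)⟩
  · right
    cases α with
    | nil =>
      refine ⟨[], hα, H, hH, ?_⟩
      funext i
      have := congrFun h (i + 1)
      simpa [blurSeq, FullBlurShift.shift] using this
    | cons a w =>
      refine ⟨w, L.language_tail hα, H, hH.mono ?_, ?_⟩
      · rintro b ⟨hb, hbH⟩
        exact ⟨L.language_tail (a := a) hb, hbH⟩
      · funext i
        have := congrFun h (i + 1)
        simpa [blurSeq, FullBlurShift.shift] using this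

/-- The shift map on a blur shift space. -/
def BlurShift.shift {A : Type u} {V : BlurFamily A} {L : ShiftSpace A} (x : BlurShift V L) :
    BlurShift V L :=
  ⟨x.1.shift, shift_mem_blurShiftSet x.2⟩

/-- `Z_L(α)`, the trace of `Z(α)` on the blur shift space. -/
def BlurShift.cyl {A : Type u} (V : BlurFamily A) (L : ShiftSpace A) (α : List A) :
    Set (BlurShift V L) :=
  {x | x.1 ∈ BlurShifts.cyl V α}

/-- `Z_L(α H̄, F)`, the trace of `Z(α H̄, F)` on the blur shift space. -/
def BlurShift.cylBlur {A : Type u} {V : BlurFamily A} (L : ShiftSpace A) (α : List A)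
    (H : V.sets) (F : Set A) : Set (BlurShift V L) :=
  {x | x.1 ∈ BlurShifts.cylBlur α H F}

/-- Generalized cylinders of a blur shift space: `Z_L(α)` and `Z_L(α H̄, F)` with `α` in the
language of `L`, `H` a blurred set containing infinitely many of the letters used in `L`, and `F`
a finite subset of `H`. -/
def IsGeneralizedCylinder {A : Type u} {V : BlurFamily A} {L : ShiftSpace A}
    (Z : Set (BlurShift V L)) : Prop :=
  (∃ α ∈ language L.carrier, Z = BlurShift.cyl V L α) ∨
    ∃ α ∈ language L.carrier, ∃ H : V.sets, (followerSet L.carrier [] ∩ H.1).Infinite ∧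
      ∃ F : Set A, F.Finite ∧ F ⊆ H.1 ∧ Z = BlurShift.cylBlur L α H F

/-- Pseudo cylinders of a blur shift space: the empty set, and the sets of all sequences showing
a given nonempty word of the blur shift space (possibly with blurred symbols) at a
given position. -/
def IsPseudoCylinder {A : Type u} {V : BlurFamily A} {L : ShiftSpace A}
    (C : Set (BlurShift V L)) : Prop :=
  C = ∅ ∨ ∃ (k : ℕ) (w : List (ExtAlphabet V)), w ≠ [] ∧
    w ∈ language (Set.range fun x : BlurShift V L => x.1.1) ∧
    C = {x | OccursAt w x.1 k}

/-- `C` is a (possibly empty, possibly infinite) union of sets with the property `P`. -/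
def IsUnionOf {X : Type u} (P : Set X → Prop) (C : Set X) : Prop :=
  ∃ S : Set (Set X), (∀ Z ∈ S, P Z) ∧ C = ⋃₀ S

/-- Finitely defined sets: both the set and its complement are unions of pseudo cylinders. -/
def IsFinitelyDefined {A : Type u} {V : BlurFamily A} {L : ShiftSpace A}
    (C : Set (BlurShift V L)) : Prop :=
  IsUnionOf IsPseudoCylinder C ∧ IsUnionOf IsPseudoCylinder Cᶜ

/-! ### Maps between blur shift spaces -/

section Maps

variable {A : Type u} {B : Type v} {V : BlurFamily A} {U : BlurFamily B}
  {L : ShiftSpace A} {K : ShiftSpace B}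

/-- `C_a = Φ⁻¹([a]_0^0)`: the points whose image has `a` as its symbol at position `0`. -/
def symbolPreimage (Φ : BlurShift V L → BlurShift U K) (a : ExtAlphabet U) :
    Set (BlurShift V L) :=
  {x | (Φ x).1 0 = a}

/-- `Φ ∘ σ = σ ∘ Φ`. -/
def ShiftCommuting (Φ : BlurShift V L → BlurShift U K) : Prop :=
  ∀ x, Φ x.shift = (Φ x).shift

/-- Generalized sliding block codes: `(Φ x)_i = ∑_a a 1_{C_a}(σ^i x)` as a symbolic sum, i.e.
the symbol of `Φ x` at position `i` is the `a` with `σ^i x ∈ C_a`, and every `C_a` is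
finitely defined. -/
def IsGeneralizedSlidingBlockCode (Φ : BlurShift V L → BlurShift U K) : Prop :=
  (∀ (x : BlurShift V L) (i : ℕ) (a : ExtAlphabet U),
    (Φ x).1 i = a ↔ BlurShift.shift^[i] x ∈ symbolPreimage Φ a) ∧
  ∀ a : ExtAlphabet U, IsFinitelyDefined (symbolPreimage Φ a)

end Maps

end BlurShifts

/-!
Call a subset of a blur shift *prodiscretely open* if membership of a point depends, locally, on
finitely many of its symbols, blurred symbols counting as isolated letters.  Unions of pseudo
cylinders are exactly the prodiscretely open sets (`isUnionOf_isPseudoCylinder_iff`), so finitely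
defined sets are the prodiscretely clopen ones.  The blur topology is coarser
(`exists_prefix_subset_of_isOpen`): a sequence of letters has the cylinders of its prefixes as
neighbourhoods, but `α H̃ H̃ ⋯` only has the sets `Z(α H̄, F)`
(`exists_cylBlur_subset_of_isOpen`).

If `Φ` is continuous and commutes with the shift, then each `C_b`, `b` a letter, is the preimage of
the open set `Z(b)`; it is therefore a union of generalized cylinders and prodiscretely open.  Its
complement is the union of the other `C_a`, each of which is prodiscretely open, for blurred `a` by
hypothesis.  The remaining conditions are continuity at `α H̃ H̃ ⋯`, tested on the neighbourhoods
`Z(Ḡ)`, `Z(Ḡ, {g})` and `Z(d ⋯ d)` of the image.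

Conversely, a generalized sliding block code satisfies `(Φ x)_i = (Φ (σ^i x))_0`, and `σ^i` is
continuous at `x` as long as `x_0, …, x_{i-1}` are letters
(`BlurShift.continuousAt_shift_iterate`).  Continuity is checked one symbol at a time.  If
`(Φ x)_i` is a letter `b`, openness of `C_b` suffices unless `x = α H̃ H̃ ⋯` with `α` of length
less than `i`; then `Φ` maps `H̃ H̃ ⋯`, a fixed point of `σ`, to `b b ⋯`, and the third condition
applies (`eventually_apply_eq_letter`).  If `(Φ x)_m` is the first blurred symbol `G̃`, then either
`x` is a sequence of letters and `C_{G̃}` contains a cylinder around `σ^m x`, or `x = α H̃ H̃ ⋯`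
with `m` at most the length of `α`, because the image of a fixed point is constant; then the second
condition applies at `σ^m x` (`eventually_apply_mem_blurred`).
-/

namespace BlurShifts

open Set Filter Topology

universe u₁ u₂

variable {A : Type u₁} {B : Type u₂} {V : BlurFamily A} {U : BlurFamily B}
  {L : ShiftSpace A} {K : ShiftSpace B}

/-! ### Sequences and cylinders -/

theorem blurSeq_of_lt {α : List A} {H : V.sets} {i : ℕ} (hi : i < α.length) :
    blurSeq α H i = Sum.inl α[i] := by
  simp [blurSeq, hi]

theorem blurSeq_of_le {α : List A} {H : V.sets} {i : ℕ} (hi : α.length ≤ i) :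
    blurSeq α H i = Sum.inr H := by
  simp [blurSeq, hi]

theorem blurSeq_add (α : List A) (H : V.sets) {m : ℕ} (hm : m ≤ α.length) (i : ℕ) :
    blurSeq α H (m + i) = blurSeq (α.drop m) H i := by
  by_cases hi : m + i < α.length
  · rw [blurSeq_of_lt hi, blurSeq_of_lt (by simp; omega)]
    simp
  · rw [blurSeq_of_le (by omega), blurSeq_of_le (by simp; omega)]

theorem FullBlurShift.apply_add_of_eq_inr (x : FullBlurShift V) {i : ℕ} {H : V.sets}
    (h : x i = Sum.inr H) (j : ℕ) : x (i + j) = Sum.inr H := by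
  induction j with
  | zero => exact h
  | succ j ih => exact x.2 _ _ ih

theorem mem_cyl {α : List A} {x : FullBlurShift V} :
    x ∈ cyl V α ↔ ∀ (i : ℕ) (hi : i < α.length), x i = Sum.inl α[i] := by
  simp [cyl, OccursAt]

theorem mem_cylBlur {α : List A} {H : V.sets} {F : Set A} {x : FullBlurShift V} :
    x ∈ cylBlur α H F ↔ x ∈ cyl V α ∧
      (x α.length = Sum.inr H ∨ ∃ h ∈ H.1 \ F, x α.length = Sum.inl h) :=
  Iff.rfl

theorem mem_cylBlur_of_eq_blurSeq {x : FullBlurShift V} {α : List A} {H : V.sets}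
    (hx : x.1 = blurSeq α H) (F : Set A) : x ∈ cylBlur α H F := by
  refine mem_cylBlur.2 ⟨mem_cyl.2 fun i hi => ?_, Or.inl ?_⟩
  · rw [hx, blurSeq_of_lt hi]
  · rw [hx, blurSeq_of_le le_rfl]

theorem cylBlur_anti {α : List A} {H : V.sets} {F F' : Set A} (h : F ⊆ F') :
    cylBlur α H F' ⊆ cylBlur α H F := by
  rintro x ⟨hx, hx' | ⟨a, ha, hx'⟩⟩
  · exact ⟨hx, Or.inl hx'⟩
  · exact ⟨hx, Or.inr ⟨a, ⟨ha.1, fun hF => ha.2 (h hF)⟩, hx'⟩⟩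

theorem isOpen_cyl (α : List A) : IsOpen (cyl V α) :=
  TopologicalSpace.isOpen_generateFrom_of_mem (Or.inl ⟨α, rfl⟩)

theorem isOpen_cylBlur (α : List A) (H : V.sets) {F : Set A} (hF : F.Finite) (hFH : F ⊆ H.1) :
    IsOpen (cylBlur α H F) :=
  TopologicalSpace.isOpen_generateFrom_of_mem (Or.inr ⟨α, H, F, hF, hFH, rfl⟩)

/-! ### Neighbourhood bases of the blur topology -/

/-- Membership in an open set depends, locally, on finitely many symbols: the blur topology is
coarser than the product of discrete topologies on the extended alphabet. -/
theorem exists_prefix_subset_of_isOpen {S : Set (FullBlurShift V)} (hS : IsOpen S)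
    {x : FullBlurShift V} (hxS : x ∈ S) :
    ∃ n, ∀ z : FullBlurShift V, (∀ i < n, z i = x i) → z ∈ S := by
  induction hS with
  | basic s hs =>
    rcases hs with ⟨α, rfl⟩ | ⟨α, H, F, -, -, rfl⟩
    · refine ⟨α.length, fun z hz => mem_cyl.2 fun i hi => ?_⟩
      rw [hz i hi]
      exact mem_cyl.1 hxS i hi
    · refine ⟨α.length + 1, fun z hz => ⟨mem_cyl.2 fun i hi => ?_, ?_⟩⟩
      · rw [hz i (by omega)]
        exact mem_cyl.1 hxS.1 i hi
      · rw [hz _ (Nat.lt_succ_self _)]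
        exact hxS.2
  | univ => exact ⟨0, fun _ _ => mem_univ _⟩
  | inter s t _ _ ihs iht =>
    obtain ⟨n, hn⟩ := ihs hxS.1
    obtain ⟨m, hm⟩ := iht hxS.2
    exact ⟨max n m, fun z hz => ⟨hn z fun i hi => hz i (lt_max_of_lt_left hi),
      hm z fun i hi => hz i (lt_max_of_lt_right hi)⟩⟩
  | sUnion T _ ih =>
    obtain ⟨s, hs, hxs⟩ := hxS
    obtain ⟨n, hn⟩ := ih s hs hxs
    exact ⟨n, fun z hz => ⟨s, hs, hn z hz⟩⟩

/-- With `isOpen_cylBlur`: the sets `Z(α H̄, F)` form a neighbourhood basis of `α H̃ H̃ ⋯`. -/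
theorem exists_cylBlur_subset_of_isOpen {S : Set (FullBlurShift V)} (hS : IsOpen S)
    {x : FullBlurShift V} (hxS : x ∈ S) {α : List A} {H : V.sets} (hx : x.1 = blurSeq α H) :
    ∃ F : Set A, F.Finite ∧ F ⊆ H.1 ∧ cylBlur α H F ⊆ S := by
  have lt_of_letter : ∀ {i : ℕ} {a : A}, x i = Sum.inl a → i < α.length := by
    intro i a h
    by_contra hi
    rw [hx, blurSeq_of_le (not_lt.1 hi)] at h
    cases h
  have agree : ∀ {F : Set A} {z : FullBlurShift V}, z ∈ cylBlur α H F →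
      ∀ i < α.length, z i = x i := by
    intro F z hz i hi
    rw [hx, blurSeq_of_lt hi]
    exact mem_cyl.1 hz.1 i hi
  induction hS with
  | basic s hs =>
    rcases hs with ⟨β, rfl⟩ | ⟨β, H', F, hF, hFH, rfl⟩
    · refine ⟨∅, finite_empty, empty_subset _, fun z hz => mem_cyl.2 fun i hi => ?_⟩
      have hxi := mem_cyl.1 hxS i hi
      rw [agree hz i (lt_of_letter hxi), hxi]
    · have hpre := mem_cyl.1 hxS.1
      rcases hxS.2 with h | ⟨h, hh, hxh⟩
      · -- The blurred symbol of `x` first appears after `α`, so `β = α` and `H' = H`.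
        have h1 : α.length ≤ β.length := by
          by_contra hlt
          rw [hx, blurSeq_of_lt (not_le.1 hlt)] at h
          cases h
        have h2 : β.length ≤ α.length := by
          by_contra hlt
          exact lt_irrefl _ (lt_of_letter (hpre α.length (not_le.1 hlt)))
        have hβ : β = α := by
          refine List.ext_getElem (le_antisymm h2 h1) fun i hi hi' => ?_
          have := hpre i hi
          rw [hx, blurSeq_of_lt hi'] at this
          exact (Sum.inl.inj this).symm
        subst hβ
        have hH : H = H' := by
          rw [hx, blurSeq_of_le le_rfl] at h
          exact Sum.inr.inj h
        subst hH
        exact ⟨F, hF, hFH, Subset.rfl⟩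
      · refine ⟨∅, finite_empty, empty_subset _, fun z hz => ⟨mem_cyl.2 fun i hi => ?_,
          Or.inr ⟨h, hh, ?_⟩⟩⟩
        · rw [agree hz i (lt_of_letter (hpre i hi)), hpre i hi]
        · rw [agree hz _ (lt_of_letter hxh), hxh]
  | univ => exact ⟨∅, finite_empty, empty_subset _, subset_univ _⟩
  | inter s t _ _ ihs iht =>
    obtain ⟨F, hF, hFH, hFs⟩ := ihs hxS.1
    obtain ⟨F', hF', hFH', hFt⟩ := iht hxS.2
    exact ⟨F ∪ F', hF.union hF', union_subset hFH hFH', subset_inter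
      ((cylBlur_anti subset_union_left).trans hFs) ((cylBlur_anti subset_union_right).trans hFt)⟩
  | sUnion T _ ih =>
    obtain ⟨s, hs, hxs⟩ := hxS
    obtain ⟨F, hF, hFH, hFs⟩ := ih s hs hxs
    exact ⟨F, hF, hFH, hFs.trans (subset_sUnion_of_mem hs)⟩

namespace BlurShift

theorem mem_cyl {α : List A} {x : BlurShift V L} :
    x ∈ cyl V L α ↔ ∀ (i : ℕ) (hi : i < α.length), x.1 i = Sum.inl α[i] :=
  BlurShifts.mem_cyl

theorem mem_cylBlur {α : List A} {H : V.sets} {F : Set A} {x : BlurShift V L} :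
    x ∈ cylBlur L α H F ↔ x ∈ cyl V L α ∧
      (x.1 α.length = Sum.inr H ∨ ∃ h ∈ H.1 \ F, x.1 α.length = Sum.inl h) :=
  Iff.rfl

theorem isOpen_cyl (α : List A) : IsOpen (cyl V L α) :=
  (BlurShifts.isOpen_cyl α).preimage continuous_subtype_val

theorem isOpen_cylBlur (α : List A) (H : V.sets) {F : Set A} (hF : F.Finite) (hFH : F ⊆ H.1) :
    IsOpen (cylBlur L α H F) :=
  (BlurShifts.isOpen_cylBlur α H hF hFH).preimage continuous_subtype_val

theorem cylBlur_mem_nhds {x : BlurShift V L} {α : List A} {H : V.sets}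
    (hx : x.1.1 = blurSeq α H) {F : Set A} (hF : F.Finite) (hFH : F ⊆ H.1) :
    cylBlur L α H F ∈ 𝓝 x :=
  (isOpen_cylBlur α H hF hFH).mem_nhds (mem_cylBlur_of_eq_blurSeq hx F)

theorem exists_prefix_subset_of_mem_nhds {S : Set (BlurShift V L)} {x : BlurShift V L}
    (hS : S ∈ 𝓝 x) : ∃ n, ∀ z : BlurShift V L, (∀ i < n, z.1 i = x.1 i) → z ∈ S := by
  obtain ⟨T, hTS, hT, hxT⟩ := mem_nhds_iff.1 hS
  obtain ⟨T, hT', rfl⟩ := isOpen_induced_iff.1 hT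
  obtain ⟨n, hn⟩ := exists_prefix_subset_of_isOpen hT' hxT
  exact ⟨n, fun z hz => hTS (hn z.1 hz)⟩

theorem exists_cylBlur_subset_of_mem_nhds {S : Set (BlurShift V L)} {x : BlurShift V L}
    (hS : S ∈ 𝓝 x) {α : List A} {H : V.sets} (hx : x.1.1 = blurSeq α H) :
    ∃ F : Set A, F.Finite ∧ F ⊆ H.1 ∧ cylBlur L α H F ⊆ S := by
  obtain ⟨T, hTS, hT, hxT⟩ := mem_nhds_iff.1 hS
  obtain ⟨T, hT', rfl⟩ := isOpen_induced_iff.1 hT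
  obtain ⟨F, hF, hFH, hFT⟩ := exists_cylBlur_subset_of_isOpen hT' hxT hx
  exact ⟨F, hF, hFH, fun z hz => hTS (hFT hz)⟩

theorem mem_cyl_ofFn {y : ℕ → A} {n : ℕ} {z : BlurShift V L} :
    z ∈ cyl V L (List.ofFn fun i : Fin n => y i) ↔ ∀ i < n, z.1 i = Sum.inl (y i) := by
  simp [mem_cyl]

theorem eventually_agree_of_letters {x : BlurShift V L} {y : ℕ → A}
    (hy : ∀ i, x.1 i = Sum.inl (y i)) (n : ℕ) : ∀ᶠ z in 𝓝 x, ∀ i < n, z.1 i = x.1 i := by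
  filter_upwards [(isOpen_cyl (List.ofFn fun i : Fin n => y i)).mem_nhds
    (mem_cyl_ofFn.2 fun i _ => hy i)] with z hz i hi
  rw [mem_cyl_ofFn.1 hz i hi, hy i]

theorem tendsto_nhds_of_forall_cyl {X : Type*} {f : X → BlurShift V L} {l : Filter X}
    {x : BlurShift V L}
    (hcyl : ∀ α, x ∈ cyl V L α → ∀ᶠ z in l, f z ∈ cyl V L α)
    (hblur : ∀ α H (F : Set A), F.Finite → F ⊆ H.1 → x ∈ cylBlur L α H F →
      ∀ᶠ z in l, f z ∈ cylBlur L α H F) : Tendsto f l (𝓝 x) := by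
  refine tendsto_subtype_rng.2 (TopologicalSpace.tendsto_nhds_generateFrom_iff.2 ?_)
  rintro s (⟨α, rfl⟩ | ⟨α, H, F, hF, hFH, rfl⟩) hx
  · exact hcyl α hx
  · exact hblur α H F hF hFH hx

/-! ### The shift map -/

theorem shift_iterate_apply (m : ℕ) (x : BlurShift V L) (i : ℕ) :
    (shift^[m] x).1 i = x.1 (m + i) := by
  induction m generalizing x with
  | zero => simp
  | succ m ih =>
    rw [Function.iterate_succ_apply, ih]
    exact congrArg x.1.1 (by omega)

theorem shift_iterate_eq_blurSeq {x : BlurShift V L} {α : List A} {H : V.sets}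
    (hx : x.1.1 = blurSeq α H) {m : ℕ} (hm : m ≤ α.length) :
    (shift^[m] x).1.1 = blurSeq (α.drop m) H := by
  funext i
  rw [shift_iterate_apply, hx, blurSeq_add α H hm]

theorem ext_iff_apply {x y : BlurShift V L} : x = y ↔ ∀ i, x.1 i = y.1 i :=
  ⟨fun h _ => h ▸ rfl, fun h => Subtype.ext (Subtype.ext (funext h))⟩

/-- The shift map is continuous at the sequences that start with a letter.  It need not be
continuous at `H̃ H̃ ⋯`, since a sequence near it may have any tail after its first symbol. -/
theorem continuousAt_shift {x : BlurShift V L} {a : A} (hx : x.1 0 = Sum.inl a) :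
    ContinuousAt shift x := by
  have prefix_iff : ∀ (α : List A) (z : BlurShift V L),
      z ∈ cyl V L (a :: α) ↔ z.1 0 = Sum.inl a ∧ z.shift ∈ cyl V L α := by
    intro α z
    simp only [mem_cyl]
    constructor
    · exact fun h => ⟨h 0 (by simp), fun i hi => h (i + 1) (by simpa using hi)⟩
    · rintro ⟨h0, h⟩ (_ | i) hi
      · exact h0
      · exact h i (by simpa using hi)
  refine tendsto_nhds_of_forall_cyl (fun α hα => ?_) fun α H F hF hFH hα => ?_
  · filter_upwards [(isOpen_cyl (a :: α)).mem_nhds ((prefix_iff α x).2 ⟨hx, hα⟩)] with z hz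
    exact ((prefix_iff α z).1 hz).2
  · filter_upwards [(isOpen_cylBlur (a :: α) H hF hFH).mem_nhds
      (mem_cylBlur.2 ⟨(prefix_iff α x).2 ⟨hx, hα.1⟩, hα.2⟩)] with z hz
    exact ⟨((prefix_iff α z).1 hz.1).2, hz.2⟩

theorem continuousAt_shift_iterate {x : BlurShift V L} (m : ℕ)
    (hx : ∀ i < m, ∃ a, x.1 i = Sum.inl a) : ContinuousAt shift^[m] x := by
  induction m with
  | zero => exact continuousAt_id
  | succ m ih =>
    rw [Function.iterate_succ']
    obtain ⟨a, ha⟩ := hx m m.lt_succ_self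
    refine ContinuousAt.comp (continuousAt_shift (a := a) ?_) (ih fun i hi => hx i (by omega))
    rw [shift_iterate_apply]
    exact ha

theorem continuousAt_shift_iterate_of_eq_blurSeq {x : BlurShift V L} {α : List A} {H : V.sets}
    (hx : x.1.1 = blurSeq α H) {m : ℕ} (hm : m ≤ α.length) : ContinuousAt shift^[m] x :=
  continuousAt_shift_iterate m fun i hi => ⟨α[i], by rw [hx, blurSeq_of_lt]⟩

end BlurShift

/-! ### Unions of generalized cylinders and of pseudo cylinders -/

theorem isUnionOf_iff {X : Type*} {P : Set X → Prop} {C : Set X} :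
    IsUnionOf P C ↔ ∀ x ∈ C, ∃ Z, P Z ∧ x ∈ Z ∧ Z ⊆ C := by
  constructor
  · rintro ⟨S, hS, rfl⟩ x ⟨Z, hZ, hx⟩
    exact ⟨Z, hS Z hZ, hx, subset_sUnion_of_mem hZ⟩
  · intro h
    refine ⟨{Z | P Z ∧ Z ⊆ C}, fun Z hZ => hZ.1, Subset.antisymm (fun x hx => ?_)
      (sUnion_subset fun Z hZ => hZ.2)⟩
    obtain ⟨Z, hP, hxZ, hZC⟩ := h x hx
    exact ⟨Z, ⟨hP, hZC⟩, hxZ⟩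

theorem isOpen_of_isUnionOf_isGeneralizedCylinder {C : Set (BlurShift V L)}
    (hC : IsUnionOf IsGeneralizedCylinder C) : IsOpen C := by
  obtain ⟨S, hS, rfl⟩ := hC
  refine isOpen_sUnion fun Z hZ => ?_
  rcases hS Z hZ with ⟨α, -, rfl⟩ | ⟨α, -, H, -, F, hF, hFH, rfl⟩
  · exact BlurShift.isOpen_cyl α
  · exact BlurShift.isOpen_cylBlur α H hF hFH

/-- Every open set is a union of cylinders, and the words and blurred sets that define them can
be read off from points of the blur shift, which makes them admissible. -/
theorem isUnionOf_isGeneralizedCylinder_of_isOpen {C : Set (BlurShift V L)} (hC : IsOpen C) :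
    IsUnionOf IsGeneralizedCylinder C := by
  refine isUnionOf_iff.2 fun x hx => ?_
  rcases x.2 with ⟨y, hyL, hy⟩ | ⟨α, hα, H, hH, hxα⟩
  · obtain ⟨n, hn⟩ := BlurShift.exists_prefix_subset_of_mem_nhds (hC.mem_nhds hx)
    refine ⟨BlurShift.cyl V L (List.ofFn fun i : Fin n => y i),
      Or.inl ⟨_, Or.inr ⟨y, hyL, ?_⟩, rfl⟩, BlurShift.mem_cyl_ofFn.2 fun i _ => hy i,
      fun z hz => hn z fun i hi => ?_⟩
    · simp [OccursAt]
    · rw [BlurShift.mem_cyl_ofFn.1 hz i hi, hy i]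
  · obtain ⟨F, hF, hFH, hFC⟩ := BlurShift.exists_cylBlur_subset_of_mem_nhds (hC.mem_nhds hx) hxα
    refine ⟨_, Or.inr ⟨α, hα, H, hH.mono fun a ha => ⟨?_, ha.2⟩, F, hF, hFH, rfl⟩,
      mem_cylBlur_of_eq_blurSeq hxα F, hFC⟩
    -- A letter that follows `α` occurs in a sequence of `L`, hence starts one.
    have : ∀ w : List A, w ++ [a] ∈ language L.carrier → [a] ∈ language L.carrier := by
      intro w
      induction w with
      | nil => exact id
      | cons b w ih => exact fun h => ih (L.language_tail h)
    exact this α ha.1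

/-- Unions of pseudo cylinders are the sets in which membership depends, locally, on finitely many
symbols: the open sets of the product of discrete topologies on the extended alphabet. -/
theorem isUnionOf_isPseudoCylinder_iff {C : Set (BlurShift V L)} :
    IsUnionOf IsPseudoCylinder C ↔
      ∀ x ∈ C, ∃ n, ∀ y : BlurShift V L, (∀ i < n, y.1 i = x.1 i) → y ∈ C := by
  rw [isUnionOf_iff]
  refine forall₂_congr fun x hx => ⟨?_, ?_⟩
  · rintro ⟨Z, rfl | ⟨k, w, -, -, rfl⟩, hxZ, hZC⟩
    · exact hxZ.elim
    · refine ⟨k + w.length, fun y hy => hZC fun i hi => ?_⟩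
      rw [hy (k + i) (by omega)]
      exact hxZ i hi
  · rintro ⟨n, hn⟩
    -- Words of pseudo cylinders are nonempty, so one symbol more than necessary is prescribed.
    refine ⟨_, Or.inr ⟨0, List.ofFn fun i : Fin (n + 1) => x.1 i, by simp,
      Or.inr ⟨_, ⟨x, rfl⟩, ?_⟩, rfl⟩, ?_, fun y hy => hn y fun i hi => ?_⟩
    · simp only [OccursAt, List.getElem_ofFn, zero_add, implies_true]
    · simp only [mem_ofPred_eq, OccursAt, List.getElem_ofFn, zero_add, implies_true]
    · have := hy i (by simp; omega)
      simpa only [List.getElem_ofFn, zero_add] using this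

theorem isUnionOf_isPseudoCylinder_of_isOpen {C : Set (BlurShift V L)} (hC : IsOpen C) :
    IsUnionOf IsPseudoCylinder C :=
  isUnionOf_isPseudoCylinder_iff.2 fun _ hx =>
    BlurShift.exists_prefix_subset_of_mem_nhds (hC.mem_nhds hx)

/-! ### Continuous shift commuting maps -/

section Maps

variable {Φ : BlurShift V L → BlurShift U K}

theorem ShiftCommuting.apply_eq (h : ShiftCommuting Φ) (x : BlurShift V L) (i : ℕ) :
    (Φ x).1 i = (Φ (BlurShift.shift^[i] x)).1 0 := by
  have : Φ (BlurShift.shift^[i] x) = BlurShift.shift^[i] (Φ x) := by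
    induction i generalizing x with
    | zero => rfl
    | succ i ih => rw [Function.iterate_succ_apply, Function.iterate_succ_apply, ih, h]
  rw [this, BlurShift.shift_iterate_apply, add_zero]

theorem shiftCommuting_of_forall_mem_symbolPreimage
    (h : ∀ (x : BlurShift V L) (i : ℕ) (a : ExtAlphabet U),
      (Φ x).1 i = a ↔ BlurShift.shift^[i] x ∈ symbolPreimage Φ a) : ShiftCommuting Φ := by
  have key : ∀ x i, (Φ (BlurShift.shift^[i] x)).1 0 = (Φ x).1 i := fun x i => (h x i _).1 rfl
  refine fun x => BlurShift.ext_iff_apply.2 fun i => ?_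
  rw [← key, ← Function.iterate_succ_apply, key]
  rfl

theorem isOpen_symbolPreimage_inl (hΦ : Continuous Φ) (b : B) :
    IsOpen (symbolPreimage Φ (Sum.inl b)) := by
  have : symbolPreimage Φ (Sum.inl b) = Φ ⁻¹' BlurShift.cyl U K [b] := by
    ext x
    simp [symbolPreimage, BlurShift.mem_cyl]
  rw [this]
  exact (BlurShift.isOpen_cyl [b]).preimage hΦ

theorem isFinitelyDefined_symbolPreimage_inl (hΦ : Continuous Φ)
    (hG : ∀ G : U.sets, IsFinitelyDefined (symbolPreimage Φ (Sum.inr G))) (b : B) :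
    IsFinitelyDefined (symbolPreimage Φ (Sum.inl b)) := by
  have union : ∀ a, IsUnionOf IsPseudoCylinder (symbolPreimage Φ a) := by
    rintro (b | G)
    · exact isUnionOf_isPseudoCylinder_of_isOpen (isOpen_symbolPreimage_inl hΦ b)
    · exact (hG G).1
  refine ⟨union _, isUnionOf_isPseudoCylinder_iff.2 fun x hx => ?_⟩
  obtain ⟨n, hn⟩ := isUnionOf_isPseudoCylinder_iff.1 (union ((Φ x).1 0)) x rfl
  refine ⟨n, fun y hy hyb => hx ?_⟩
  have hxy : (Φ y).1 0 = (Φ x).1 0 := hn y hy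
  exact hxy.symm.trans hyb

theorem exists_image_cylBlur_subset (hΦ : Continuous Φ) {x : BlurShift V L} {α : List A}
    {H : V.sets} (hx : x.1.1 = blurSeq α H) {S : Set (BlurShift U K)} (hS : S ∈ 𝓝 (Φ x)) :
    ∃ F : Set A, F.Finite ∧ F ⊆ H.1 ∧ ∀ y ∈ BlurShift.cylBlur L α H F, Φ y ∈ S :=
  BlurShift.exists_cylBlur_subset_of_mem_nhds (hΦ.continuousAt hS) hx

theorem finite_letters_of_continuous (hΦ : Continuous Φ) {x : BlurShift V L} {α : List A}
    {H : V.sets} {G : U.sets} (hx : x.1.1 = blurSeq α H) (hy : (Φ x).1.1 = blurSeq [] G)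
    {g : B} (hg : g ∈ G.1) :
    {h ∈ H.1 | ∃ y ∈ symbolPreimage Φ (Sum.inl g), y ∈ BlurShift.cyl V L (α ++ [h])}.Finite := by
  obtain ⟨F, hF, -, hFG⟩ := exists_image_cylBlur_subset hΦ hx
    (BlurShift.cylBlur_mem_nhds hy (finite_singleton g) (singleton_subset_iff.2 hg))
  refine hF.subset ?_
  rintro h ⟨hh, y, hyg, hyh⟩
  by_contra hhF
  rw [BlurShift.mem_cyl] at hyh
  have hyg : (Φ y).1 0 = Sum.inl g := hyg
  have hyF : y ∈ BlurShift.cylBlur L α H F := by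
    refine BlurShift.mem_cylBlur.2 ⟨BlurShift.mem_cyl.2 fun i hi => ?_,
      Or.inr ⟨h, ⟨hh, hhF⟩, ?_⟩⟩
    · rw [hyh i (by simp; omega), List.getElem_append_left hi]
    · rw [hyh _ (by simp)]
      simp
  rcases (hFG y hyF).2 with h' | ⟨g', hg', h'⟩
  · cases hyg.symm.trans h'
  · exact hg'.2 (Sum.inl.inj (hyg.symm.trans h')).symm

theorem exists_cylBlur_constant_of_continuous (hΦ : Continuous Φ) (hσ : ShiftCommuting Φ)
    {x : BlurShift V L} {H : V.sets} {d : B} (hx : x.1.1 = blurSeq [] H)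
    (hd : ∀ i, (Φ x).1 i = Sum.inl d) (M : ℕ) :
    ∃ F : Set A, F.Finite ∧ F ⊆ H.1 ∧
      ∀ i ≤ M, BlurShift.shift^[i] '' BlurShift.cylBlur L [] H F ⊆
        symbolPreimage Φ (Sum.inl d) := by
  obtain ⟨F, hF, hFH, hFd⟩ := exists_image_cylBlur_subset hΦ hx
    (BlurShift.eventually_agree_of_letters hd (M + 1))
  refine ⟨F, hF, hFH, fun i hi => ?_⟩
  rintro _ ⟨y, hy, rfl⟩
  exact (hσ.apply_eq y i).symm.trans ((hFd y hy i (by omega)).trans (hd i))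

/-! ### Continuity from the behaviour at blurred sequences -/

/-- The image of `H̃ H̃ ⋯`, a fixed point of the shift, is constant; so the image of
`α H̃ H̃ ⋯` is constant from position `|α|` on. -/
theorem ShiftCommuting.apply_eq_of_blurSeq (hσ : ShiftCommuting Φ) {x : BlurShift V L}
    {α : List A} {H : V.sets} (hx : x.1.1 = blurSeq α H) {i j : ℕ} (hi : α.length ≤ i)
    (hj : α.length ≤ j) : (Φ x).1 i = (Φ x).1 j := by
  rw [hσ.apply_eq, hσ.apply_eq x j]
  have : BlurShift.shift^[i] x = BlurShift.shift^[j] x := by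
    refine BlurShift.ext_iff_apply.2 fun k => ?_
    rw [BlurShift.shift_iterate_apply, BlurShift.shift_iterate_apply, hx, blurSeq_of_le (by omega),
      blurSeq_of_le (by omega)]
  rw [this]

theorem eventually_apply_eq_letter (hσ : ShiftCommuting Φ)
    (hopen : ∀ b : B, IsOpen (symbolPreimage Φ (Sum.inl b)))
    (hconst : ∀ (x : BlurShift V L) (H : V.sets) (d : B),
      x.1.1 = blurSeq [] H → (∀ i, (Φ x).1 i = Sum.inl d) →
        ∀ M : ℕ, 1 ≤ M → ∃ F : Set A, F.Finite ∧ F ⊆ H.1 ∧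
          ∀ i ≤ M, BlurShift.shift^[i] '' BlurShift.cylBlur L [] H F ⊆ symbolPreimage Φ (Sum.inl d))
    {x : BlurShift V L} {i : ℕ} {b : B} (hb : (Φ x).1 i = Sum.inl b) :
    ∀ᶠ y in 𝓝 x, (Φ y).1 i = Sum.inl b := by
  have of_continuousAt : ContinuousAt BlurShift.shift^[i] x →
      ∀ᶠ y in 𝓝 x, (Φ y).1 i = Sum.inl b := by
    intro hc
    filter_upwards [hc ((hopen b).mem_nhds ((hσ.apply_eq x i).symm.trans hb))] with y hy
    exact (hσ.apply_eq y i).trans hy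
  rcases x.2 with ⟨y, -, hy⟩ | ⟨α, -, H, -, hxα⟩
  · exact of_continuousAt (BlurShift.continuousAt_shift_iterate i fun j _ => ⟨_, hy j⟩)
  · rcases le_or_gt i α.length with hi | hi
    · exact of_continuousAt (BlurShift.continuousAt_shift_iterate_of_eq_blurSeq hxα hi)
    · -- The shift need not be continuous at `H̃ H̃ ⋯`, so continuity handles only `|α|` shifts;
      -- `hconst` controls the remaining `i - |α|`.
      have hx' : (BlurShift.shift^[α.length] x).1.1 = blurSeq [] H := by
        rw [BlurShift.shift_iterate_eq_blurSeq hxα le_rfl, List.drop_length]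
      have hd : ∀ j, (Φ (BlurShift.shift^[α.length] x)).1 j = Sum.inl b := by
        intro j
        rw [hσ.apply_eq, ← Function.iterate_add_apply, ← hσ.apply_eq,
          hσ.apply_eq_of_blurSeq hxα (by omega) hi.le, hb]
      obtain ⟨F, hF, hFH, hFb⟩ := hconst _ H b hx' hd (i - α.length) (by omega)
      filter_upwards [BlurShift.continuousAt_shift_iterate_of_eq_blurSeq hxα le_rfl
        (BlurShift.cylBlur_mem_nhds hx' hF hFH)] with y hy
      have := hFb _ le_rfl ⟨_, hy, rfl⟩
      rw [← Function.iterate_add_apply, Nat.sub_add_cancel hi.le] at this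
      exact (hσ.apply_eq y i).trans this

/-- If `Φ` maps `α H̃ H̃ ⋯` to `G̃ G̃ ⋯`, the images of nearby points start in `Ḡ \ F`: all but
finitely many letters of `H` following `α` lead into `Ḡ`, and only finitely many of them lead to a
letter of the finite set `F`. -/
theorem eventually_apply_zero_mem_blurred {x : BlurShift V L} {α : List A} {H : V.sets}
    {G : U.sets} {F' : Set A} (hx : x.1.1 = blurSeq α H) (hy : (Φ x).1 0 = Sum.inr G)
    (hF' : F'.Finite) (hFH' : F' ⊆ H.1)
    (himage : Φ '' BlurShift.cylBlur L α H F' ⊆ BlurShift.cylBlur K [] G ∅)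
    (hfin : ∀ g ∈ G.1, {h ∈ H.1 | ∃ y ∈ symbolPreimage Φ (Sum.inl g),
      y ∈ BlurShift.cyl V L (α ++ [h])}.Finite)
    {F : Set B} (hF : F.Finite) (hFG : F ⊆ G.1) :
    ∀ᶠ z in 𝓝 x, (Φ z).1 0 = Sum.inr G ∨ ∃ g ∈ G.1 \ F, (Φ z).1 0 = Sum.inl g := by
  set E : Set A := F' ∪ ⋃ g ∈ F, {h ∈ H.1 | ∃ y ∈ symbolPreimage Φ (Sum.inl g),
    y ∈ BlurShift.cyl V L (α ++ [h])} with hE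
  have hEfin : E.Finite := hF'.union (hF.biUnion fun g hg => hfin g (hFG hg))
  have hEH : E ⊆ H.1 := union_subset hFH' (iUnion₂_subset fun g _ h hh => hh.1)
  filter_upwards [BlurShift.cylBlur_mem_nhds hx hEfin hEH] with z hz
  rcases (himage ⟨z, cylBlur_anti subset_union_left hz, rfl⟩).2 with h | ⟨g, hg, hzg⟩
  · exact Or.inl h
  · have hzg : (Φ z).1 0 = Sum.inl g := hzg
    refine Or.inr ⟨g, ⟨hg.1, fun hgF => ?_⟩, hzg⟩
    have hpre := BlurShift.mem_cyl.1 hz.1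
    rcases hz.2 with hzH | ⟨h, hh, hzh⟩
    · -- A point of `Z(α H̄)` whose symbol after `α` is `H̃` is `x` itself.
      have : z = x := by
        refine BlurShift.ext_iff_apply.2 fun i => ?_
        rcases lt_or_ge i α.length with hi | hi
        · rw [hpre i hi, hx, blurSeq_of_lt hi]
        · rw [hx, blurSeq_of_le hi, ← Nat.add_sub_cancel' hi]
          exact z.1.apply_add_of_eq_inr hzH _
      rw [this, hy] at hzg
      cases hzg
    · refine hh.2 (Or.inr (mem_iUnion₂.2 ⟨g, hgF, hh.1, z, hzg, BlurShift.mem_cyl.2 ?_⟩))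
      intro i hi
      rcases lt_or_ge i α.length with hi' | hi'
      · rw [hpre i hi', List.getElem_append_left hi']
      · obtain rfl : i = α.length := by
          simp at hi
          omega
        simpa using hzh

theorem eventually_apply_mem_blurred (hσ : ShiftCommuting Φ)
    (hG : ∀ G : U.sets, IsFinitelyDefined (symbolPreimage Φ (Sum.inr G)))
    (hblur : ∀ (x : BlurShift V L) (α : List A) (H : V.sets) (G : U.sets),
      x.1.1 = blurSeq α H → (Φ x).1.1 = blurSeq [] G →
        (∃ F : Set A, F.Finite ∧ F ⊆ H.1 ∧
          Φ '' BlurShift.cylBlur L α H F ⊆ BlurShift.cylBlur K [] G ∅) ∧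
        (∀ g ∈ G.1, {h ∈ H.1 | ∃ y ∈ symbolPreimage Φ (Sum.inl g),
          y ∈ BlurShift.cyl V L (α ++ [h])}.Finite))
    {x : BlurShift V L} {m : ℕ} {G : U.sets} (hm : (Φ x).1 m = Sum.inr G)
    (hlt : ∀ i < m, ∃ b, (Φ x).1 i = Sum.inl b) {F : Set B} (hF : F.Finite) (hFG : F ⊆ G.1) :
    ∀ᶠ z in 𝓝 x, (Φ z).1 m = Sum.inr G ∨ ∃ g ∈ G.1 \ F, (Φ z).1 m = Sum.inl g := by
  rcases x.2 with ⟨y, -, hy⟩ | ⟨α, -, H, -, hxα⟩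
  · obtain ⟨n, hn⟩ := isUnionOf_isPseudoCylinder_iff.1 (hG G).1 (BlurShift.shift^[m] x)
      ((hσ.apply_eq x m).symm.trans hm)
    filter_upwards [BlurShift.eventually_agree_of_letters hy (m + n)] with z hz
    refine Or.inl ((hσ.apply_eq z m).trans (hn _ fun i hi => ?_))
    rw [BlurShift.shift_iterate_apply, BlurShift.shift_iterate_apply, hz _ (by omega)]
  · -- The image is constant from position `|α|` on, so a blurred symbol
    -- appears there at the latest.
    have hmα : m ≤ α.length := by
      by_contra hlt'
      obtain ⟨b, hb⟩ := hlt α.length (not_le.1 hlt')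
      rw [hσ.apply_eq_of_blurSeq hxα le_rfl (not_le.1 hlt').le, hm] at hb
      cases hb
    have hx' := BlurShift.shift_iterate_eq_blurSeq hxα hmα
    have h0 : (Φ (BlurShift.shift^[m] x)).1 0 = Sum.inr G := (hσ.apply_eq x m).symm.trans hm
    have hΦ' : (Φ (BlurShift.shift^[m] x)).1.1 = blurSeq [] G := by
      funext i
      rw [blurSeq_of_le (by simp), ← zero_add i]
      exact (Φ (BlurShift.shift^[m] x)).1.apply_add_of_eq_inr h0 i
    obtain ⟨⟨F', hF', hFH', himage⟩, hfin⟩ := hblur _ _ H G hx' hΦ'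
    filter_upwards [BlurShift.continuousAt_shift_iterate_of_eq_blurSeq hxα hmα
      (eventually_apply_zero_mem_blurred hx' h0 hF' hFH' himage hfin hF hFG)] with z hz
    rw [hσ.apply_eq z m]
    exact hz

end Maps

end BlurShifts

open BlurShifts in
theorem mainTheorem6 {A : Type u} {B : Type v} (V : BlurFamily A) (U : BlurFamily B)
    (L : ShiftSpace A) (K : ShiftSpace B) (Φ : BlurShift V L → BlurShift U K)
    (hΦ : ∀ G : U.sets, IsFinitelyDefined (symbolPreimage Φ (Sum.inr G))) :
    (Continuous Φ ∧ ShiftCommuting Φ) ↔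
      (IsGeneralizedSlidingBlockCode Φ ∧
        -- (i)
        (∀ b : B, IsUnionOf IsGeneralizedCylinder (symbolPreimage Φ (Sum.inl b))) ∧
        -- (ii)
        (∀ (x : BlurShift V L) (α : List A) (H : V.sets) (G : U.sets),
          x.1.1 = blurSeq α H → (Φ x).1.1 = blurSeq [] G →
            (∃ F : Set A, F.Finite ∧ F ⊆ H.1 ∧
              Φ '' BlurShift.cylBlur L α H F ⊆ BlurShift.cylBlur K [] G ∅) ∧
            (∀ g ∈ G.1, {h ∈ H.1 | ∃ y ∈ symbolPreimage Φ (Sum.inl g),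
              y ∈ BlurShift.cyl V L (α ++ [h])}.Finite)) ∧
        -- (iii)
        (∀ (x : BlurShift V L) (H : V.sets) (d : B),
          x.1.1 = blurSeq [] H → (∀ i, (Φ x).1 i = Sum.inl d) →
            ∀ M : ℕ, 1 ≤ M → ∃ F : Set A, F.Finite ∧ F ⊆ H.1 ∧
              ∀ i ≤ M, BlurShift.shift^[i] '' BlurShift.cylBlur L [] H F ⊆
                symbolPreimage Φ (Sum.inl d))) := by
  open Filter Topology in
  constructor
  · rintro ⟨hc, hσ⟩
    refine ⟨⟨fun x i a => by rw [hσ.apply_eq]; rfl, ?_⟩,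
      fun b => isUnionOf_isGeneralizedCylinder_of_isOpen (isOpen_symbolPreimage_inl hc b),
      fun x α H G hx hy => ⟨?_, fun g hg => finite_letters_of_continuous hc hx hy hg⟩,
      fun x H d hx hd M _ => exists_cylBlur_constant_of_continuous hc hσ hx hd M⟩
    · rintro (b | G)
      · exact isFinitelyDefined_symbolPreimage_inl hc hΦ b
      · exact hΦ G
    · obtain ⟨F, hF, hFH, h⟩ := exists_image_cylBlur_subset hc hx
        (BlurShift.cylBlur_mem_nhds hy Set.finite_empty (Set.empty_subset _))
      exact ⟨F, hF, hFH, Set.image_subset_iff.2 h⟩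
  · rintro ⟨⟨hcode, -⟩, hunion, hblur, hconst⟩
    have hσ := shiftCommuting_of_forall_mem_symbolPreimage hcode
    have letter : ∀ {x : BlurShift V L} {i : ℕ} {b : B}, (Φ x).1 i = Sum.inl b →
        ∀ᶠ y in 𝓝 x, (Φ y).1 i = Sum.inl b :=
      eventually_apply_eq_letter hσ
        (fun b => isOpen_of_isUnionOf_isGeneralizedCylinder (hunion b)) hconst
    have word : ∀ {x : BlurShift V L} (β : List B), Φ x ∈ BlurShift.cyl U K β →
        ∀ᶠ y in 𝓝 x, Φ y ∈ BlurShift.cyl U K β := by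
      intro x β hβ
      have : ∀ᶠ y in 𝓝 x, ∀ i : Fin β.length, (Φ y).1 i = Sum.inl β[i] :=
        eventually_all.2 fun i => letter (BlurShift.mem_cyl.1 hβ i i.2)
      filter_upwards [this] with y hy
      exact BlurShift.mem_cyl.2 fun i hi => hy ⟨i, hi⟩
    refine ⟨continuous_iff_continuousAt.2 fun x => BlurShift.tendsto_nhds_of_forall_cyl word
      fun β G F hF hFG hx => ?_, hσ⟩
    have next : ∀ᶠ y in 𝓝 x, (Φ y).1 β.length = Sum.inr G ∨
        ∃ g ∈ G.1 \ F, (Φ y).1 β.length = Sum.inl g := by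
      rcases hx.2 with h | ⟨g, hg, h⟩
      · exact eventually_apply_mem_blurred hσ hΦ hblur h
          (fun i hi => ⟨_, BlurShift.mem_cyl.1 hx.1 i hi⟩) hF hFG
      · exact (letter h).mono fun y hy => Or.inr ⟨g, hg, hy⟩
    exact ((word β hx.1).and next).mono fun y hy => BlurShift.mem_cylBlur.2 hy
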